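/- There are absolute constants $C_1,C_2>0$ with the following property. Let $d,T\ge 1$, $\epsilon>0$, $0<\delta<1$, $\lambda>0$. Let $\ell:\mathbb{R}\to\mathbb{R}$ be convex and $\beta$-strongly smooth, i.e. $\ell$ is differentiable and $\ell(v)\le \ell(u)+(v-u)\,\ell'(u)+\frac{\beta}{2}(v-u)^2$ for all $u,v\in\mathbb{R}$. Let $(\mathbf{x}_t,y_t)\in\mathbb{R}^d\times\{-1,+1\}$, $t=1,\dots,T$, be fixed examples with $\max_t\|\mathbf{x}_t\|_1=\gamma$. Let $$k=\frac{C_1}{\epsilon^4}\log^3(d/\delta)\,\max\left\{1,\frac{\beta^2\gamma^4}{\lambda^2}\right\},\qquad s=\frac{C_2}{\epsilon^2}\log^2(d/\delta)\,\max\left\{1,\frac{\beta\gamma^2}{\lambda}\right\},$$ where $s$ is rounded up to an integer and then $k$ is rounded up to a multiple of $s$. For each row $j\in[s]$ and each index $i\in[d]$ choose a bucket $h_j(i)\in[k/s]$ and a sign $\sigma_j(i)\in\{-1,+1\}$, all uniformly at random and independently. Let $A\in\mathbb{R}^{k\times d}$, with rows indexed by pairs $(j,c)\in[s]\times[k/s]$,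 be the Count-Sketch matrix with $A_{(j,c),i}=\sigma_j(i)$ if $h_j(i)=c$ and $A_{(j,c),i}=0$ otherwise, and let $R=\frac{1}{\sqrt{s}}A$. Let $\mathbf{w}_*$ be the minimizer over $\mathbf{w}\in\mathbb{R}^d$ of $$L(\mathbf{w})=\frac1T\sum_{t=1}^T\ell(y_t\mathbf{w}^T\mathbf{x}_t)+\frac{\lambda}{2}\|\mathbf{w}\|_2^2,$$ let $\mathbf{z}_*$ be the minimizer over $\mathbf{z}\in\mathbb{R}^k$ of $$\hat L(\mathbf{z})=\frac1T\sum_{t=1}^T\ell(y_t\mathbf{z}^TR\mathbf{x}_t)+\frac{\lambda}{2}\|\mathbf{z}\|_2^2,$$ and let $\mathbf{w}_{\mathrm{est}}\in\mathbb{R}^d$ be the Count-Sketch estimate obtained from $\mathbf{z}_*$: its $i$-th coordinate is a median of the values $\sqrt{s}\,\sigma_j(i)\,(\mathbf{z}_*)_{j,h_j(i)}$, $j\in[s]$ (if $s$ is even, any number between the two middle values is allowed). Then with probability at least $1-\delta$ over the choice of $R$, $$\|\mathbf{w}_*-\mathbf{w}_{\mathrm{est}}\|_\infty\le\epsilon\,\|\mathbf{w}_*\|_1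 .$$ -/

import Mathlib

open scoped Matrix

noncomputable section

/-- `f : ℝ → ℝ` is `β`-strongly smooth: it is differentiable everywhere and satisfies the
quadratic upper bound with parameter `β`. -/
def StronglySmooth (β : ℝ) (f : ℝ → ℝ) : Prop :=
  Differentiable ℝ f ∧
    ∀ x y : ℝ, f y ≤ f x + (y - x) * deriv f x + β / 2 * (y - x) ^ 2

/-- The `ℓ₁` norm of a real vector. -/
def l1Norm {ι : Type*} [Fintype ι] (v : ι → ℝ) : ℝ := ∑ i, |v i|

/-- The `ℓ₂`-regularized empirical objective
`w ↦ (1/T) ∑ₜ ℓ (yₜ wᵀ xₜ) + (lam/2) ‖w‖₂²` of the examples `(xₜ, yₜ)`, `t = 1, …, T`. -/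
def objective {ι : Type*} [Fintype ι] {T : ℕ} (ℓ : ℝ → ℝ) (lam : ℝ)
    (x : Fin T → ι → ℝ) (y : Fin T → ℝ) (w : ι → ℝ) : ℝ :=
  (1 / (T : ℝ)) * ∑ t, ℓ (y t * (w ⬝ᵥ x t)) + lam / 2 * ∑ i, w i ^ 2

/-- `w` is a global minimizer of `F`. -/
def IsMinimizer {α : Type*} (F : α → ℝ) (w : α) : Prop := ∀ v, F w ≤ F v

/-- The randomness of a Count-Sketch with `s` rows (hash tables) of `b` buckets each, for
vectors indexed by `Fin d`: a bucket `h_j(i)` (first component) and a sign bit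
(second component) for every row `j` and every index `i`. -/
abbrev Hashing (s b d : ℕ) : Type :=
  (Fin s → Fin d → Fin b) × (Fin s → Fin d → Bool)

/-- The sign `σ_j(i) ∈ {1, -1}`. -/
def Hashing.sign {s b d : ℕ} (H : Hashing s b d) (j : Fin s) (i : Fin d) : ℝ :=
  if H.2 j i then 1 else -1

/-- The Count-Sketch matrix `A`, of size `k × d` with `k = s * b`; the row index `(j, c)` is
bucket `c` of table `j`. -/
def countSketchMatrix {s b d : ℕ} (H : Hashing s b d) : Matrix (Fin s × Fin b) (Fin d) ℝ :=
  Matrix.of fun p i => if H.1 p.1 i = p.2 then H.sign p.1 i else 0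

/-- The scaled Count-Sketch matrix `R = A / √s`. -/
def scaledCountSketchMatrix {s b d : ℕ} (H : Hashing s b d) :
    Matrix (Fin s × Fin b) (Fin d) ℝ :=
  (1 / √(s : ℝ)) • countSketchMatrix H

/-- `m` is a median of the values `v 1, …, v s`: at least half of them are `≤ m` and at least
half of them are `≥ m`. For even `s` every point between the two middle values qualifies. -/
def IsMedian {s : ℕ} (v : Fin s → ℝ) (m : ℝ) : Prop :=
  s ≤ 2 * (Finset.univ.filter fun j => v j ≤ m).card ∧
    s ≤ 2 * (Finset.univ.filter fun j => m ≤ v j).card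

/-- `west` is an output of Count-Sketch recovery on `√s z`: its `i`-th coordinate is a median
of the values `√s σ_j(i) z_{j, h_j(i)}` over the rows `j`. -/
def IsCountSketchRecovery {s b d : ℕ} (H : Hashing s b d) (z : Fin s × Fin b → ℝ)
    (west : Fin d → ℝ) : Prop :=
  ∀ i, IsMedian (fun j => √(s : ℝ) * H.sign j i * z (j, H.1 j i)) (west i)

/-- The nominal sketch size `(C₁/ε⁴) log³(d/δ) max {1, β²γ⁴/lam²}`. -/
def nominalSize (C₁ ε δ : ℝ) (d : ℕ) (β γ lam : ℝ) : ℝ :=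
  C₁ / ε ^ 4 * Real.log (d / δ) ^ 3 * max 1 (β ^ 2 * γ ^ 4 / lam ^ 2)

/-- The nominal sketch depth `(C₂/ε²) log²(d/δ) max {1, βγ²/lam}`. -/
def nominalDepth (C₂ ε δ : ℝ) (d : ℕ) (β γ lam : ℝ) : ℝ :=
  C₂ / ε ^ 2 * Real.log (d / δ) ^ 2 * max 1 (β * γ ^ 2 / lam)

/-- The depth `s`: the nominal depth rounded up to an integer. -/
def sketchDepth (C₂ ε δ : ℝ) (d : ℕ) (β γ lam : ℝ) : ℕ :=
  ⌈nominalDepth C₂ ε δ d β γ lam⌉₊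

/-- The width `k / s` of each row, where the size `k` is the nominal size rounded up to a
multiple of the depth `s`. -/
def sketchWidth (C₁ C₂ ε δ : ℝ) (d : ℕ) (β γ lam : ℝ) : ℕ :=
  ⌈nominalSize C₁ ε δ d β γ lam / (sketchDepth C₂ ε δ d β γ lam : ℝ)⌉₊

end

/-! Stationarity expresses `w` and `z` through the `x t` and the `R *ᵥ x t`, weighted by derivatives
of `ℓ`. Hence `z - R w = R v`, where `v` combines the `x t` with weights proportional to the
differences `D t` of these derivatives. Co-coercivity bounds `∑ D²` by `-βλT (‖R v‖₂² + ⟨v, (RᵀR -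
1) w⟩)`. Hölder, with `‖v‖₁` at most `γ/λ` times the mean of `|D|`, then gives `‖z - R w‖₂² ≤
(βγ²/λ) q²/4` whenever `‖(RᵀR - 1) w‖_∞ ≤ q` (`sum_sq_sub_mulVec_minimizer_le`). This step is
deterministic and needs no norm preservation by `R`.

The hashing must therefore avoid only two bad events. The off-diagonal entries of `RᵀR` are averages
of `s` independent subgaussian signed collisions, so a Chernoff and a union bound make them all at
most `a` in absolute value, whence `q = a ‖w‖₁` (`card_filter_overlap_le`). The vector `w` is fixed
before hashing, so Chebyshev in one row and a Chernoff bound over rows show that at most a quarter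
of the rows estimate a given coordinate badly (`card_filter_error_le`).

Outside these events the perturbation `z - R w` spoils fewer than a quarter of the rows more, so the
median survives (`recovery_error_le`). -/

/-! ### Convex smooth losses and the deterministic perturbation bound -/

/-- A differentiable convex function lies above its tangents. -/
theorem ConvexOn.add_mul_deriv_le {f : ℝ → ℝ} (hc : ConvexOn ℝ Set.univ f)
    (hf : Differentiable ℝ f) (u v : ℝ) : f u + (v - u) * deriv f u ≤ f v := by
  rcases lt_trichotomy u v with h | h | h
  · have := hc.deriv_le_slope (Set.mem_univ u) (Set.mem_univ v) h (hf u)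
    rw [slope_def_field, le_div_iff₀ (by linarith)] at this
    linarith
  · simp [h]
  · have := hc.slope_le_deriv (Set.mem_univ v) (Set.mem_univ u) h (hf u)
    rw [slope_def_field, div_le_iff₀ (by linarith)] at this
    linarith

theorem StronglySmooth.nonneg_of_convexOn {β : ℝ} {f : ℝ → ℝ} (hf : StronglySmooth β f)
    (hc : ConvexOn ℝ Set.univ f) : 0 ≤ β := by
  have h1 := hc.add_mul_deriv_le hf.1 0 1
  have h2 := hf.2 0 1
  linarith

/-- The derivative of a convex `β`-strongly smooth function is co-coercive. -/
theorem StronglySmooth.sq_deriv_sub_le {β : ℝ} {f : ℝ → ℝ} (hf : StronglySmooth β f)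
    (hc : ConvexOn ℝ Set.univ f) (x y : ℝ) :
    (deriv f x - deriv f y) ^ 2 ≤ β * ((deriv f x - deriv f y) * (x - y)) := by
  have tangent := hc.add_mul_deriv_le hf.1
  -- The values of `f` at `y + cΔ` and `x - cΔ`, with `Δ` the difference of derivatives, lie above
  -- the tangent at one point and below the parabola at the other; adding the inequalities cancels
  -- `f x` and `f y`. The best `c` is `1 / β`; for `β = 0` a large `c` gives a contradiction.
  have step : ∀ c : ℝ, (2 * c - β * c ^ 2) * (deriv f x - deriv f y) ^ 2 ≤
      (deriv f x - deriv f y) * (x - y) := by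
    intro c
    have h1 := tangent x (y + c * (deriv f x - deriv f y))
    have h2 := hf.2 y (y + c * (deriv f x - deriv f y))
    have h3 := tangent y (x - c * (deriv f x - deriv f y))
    have h4 := hf.2 x (x - c * (deriv f x - deriv f y))
    nlinarith
  rcases (hf.nonneg_of_convexOn hc).eq_or_lt with h0 | hpos
  · subst h0
    set D := deriv f x - deriv f y
    by_contra hcon
    have hD : 0 < D ^ 2 := by linarith
    have h := step ((D * (x - y) + 1) / (2 * D ^ 2))
    have : (2 * ((D * (x - y) + 1) / (2 * D ^ 2)) - 0 * ((D * (x - y) + 1) / (2 * D ^ 2)) ^ 2)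
        * D ^ 2 = D * (x - y) + 1 := by
      have hD0 : D ≠ 0 := by
        rintro h0
        simp [h0] at hD
      field_simp
      ring
    linarith
  · have h := step (1 / β)
    have h2 : 2 * (1 / β) - β * (1 / β) ^ 2 = 1 / β := by field_simp; ring
    rw [h2, one_div, inv_mul_le_iff₀ hpos] at h
    exact h

/-- First-order optimality of a minimizer of the regularized objective. -/
theorem IsMinimizer.objective_stationary {ι : Type*} [Fintype ι] {T : ℕ} {ℓ : ℝ → ℝ} {lam : ℝ}
    {x : Fin T → ι → ℝ} {y : Fin T → ℝ} {w : ι → ℝ} (hℓ : Differentiable ℝ ℓ)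
    (hw : IsMinimizer (objective ℓ lam x y) w) (i : ι) :
    lam * w i + (1 / (T : ℝ)) * ∑ t, deriv ℓ (y t * (w ⬝ᵥ x t)) * y t * x t i = 0 := by
  classical
  have hd : HasDerivAt (fun r : ℝ => objective ℓ lam x y (w + r • Pi.single i 1))
      ((1 / (T : ℝ)) * ∑ t, deriv ℓ (y t * (w ⬝ᵥ x t)) * (y t * x t i) +
        lam / 2 * ∑ k, 2 * w k * (Pi.single i 1 : ι → ℝ) k) 0 := by
    unfold objective
    refine ((HasDerivAt.fun_sum fun t _ => ?_).const_mul _).add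
      ((HasDerivAt.fun_sum fun k _ => ?_).const_mul _)
    · have h1 : HasDerivAt (fun r : ℝ => y t * ((w + r • Pi.single i 1) ⬝ᵥ x t))
          (y t * x t i) 0 := by
        have : (fun r : ℝ => y t * ((w + r • Pi.single i 1) ⬝ᵥ x t)) =
            fun r : ℝ => y t * (w ⬝ᵥ x t + r * x t i) := by
          funext r
          simp [add_dotProduct, smul_dotProduct]
        rw [this]
        simpa using (((hasDerivAt_id (0 : ℝ)).mul_const (x t i)).const_add
          (w ⬝ᵥ x t)).const_mul (y t)
      have h2 : HasDerivAt ℓ (deriv ℓ (y t * (w ⬝ᵥ x t)))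
          (y t * ((w + (0 : ℝ) • Pi.single i 1) ⬝ᵥ x t)) := by
        simpa using (hℓ (y t * (w ⬝ᵥ x t))).hasDerivAt
      exact h2.comp (0 : ℝ) h1
    · have h1 : HasDerivAt (fun r : ℝ => (w + r • (Pi.single i 1 : ι → ℝ)) k)
          ((Pi.single i 1 : ι → ℝ) k) 0 := by
        simpa using ((hasDerivAt_id (0 : ℝ)).mul_const ((Pi.single i 1 : ι → ℝ) k)).const_add (w k)
      simpa using h1.fun_pow 2
  have hmin : IsLocalMin (fun r : ℝ => objective ℓ lam x y (w + r • Pi.single i 1)) 0 :=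
    Filter.Eventually.of_forall fun r => by simpa using hw (w + r • Pi.single i 1)
  have h := hmin.hasDerivAt_eq_zero hd
  simp only [Pi.single_apply, mul_ite, mul_one, mul_zero, Finset.sum_ite_eq',
    Finset.mem_univ, if_true] at h
  simp only [← mul_assoc] at h
  linarith

/-- The sketched minimizer is close to the sketch of the minimizer whenever `Rᵀ R` nearly fixes
the latter. -/
theorem sum_sq_sub_mulVec_minimizer_le {ι κ : Type*} [Fintype ι] [Fintype κ] {T : ℕ} (hT : 0 < T)
    {ℓ : ℝ → ℝ} {lam β γ q : ℝ} {x : Fin T → ι → ℝ} {y : Fin T → ℝ} {R : Matrix κ ι ℝ}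
    {w : ι → ℝ} {z : κ → ℝ} (hlam : 0 < lam) (hc : ConvexOn ℝ Set.univ ℓ)
    (hs : StronglySmooth β ℓ) (hy : ∀ t, y t = 1 ∨ y t = -1) (hx : ∀ t, l1Norm (x t) ≤ γ)
    (hq0 : 0 ≤ q) (hw : IsMinimizer (objective ℓ lam x y) w)
    (hz : IsMinimizer (objective ℓ lam (fun t => R *ᵥ x t) y) z)
    (hq : ∀ i, |(Rᵀ *ᵥ (R *ᵥ w)) i - w i| ≤ q) :
    ∑ p, (z p - (R *ᵥ w) p) ^ 2 ≤ β * γ ^ 2 / lam * (q ^ 2 / 4) := by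
  have hT' : (0 : ℝ) < T := by exact_mod_cast hT
  set D : Fin T → ℝ := fun t =>
    deriv ℓ (y t * (z ⬝ᵥ R *ᵥ x t)) * y t - deriv ℓ (y t * (w ⬝ᵥ x t)) * y t with hD
  set v : ι → ℝ := fun i => -(1 / (lam * T)) * ∑ t, D t * x t i with hv
  have hww : ∀ i, w i = -(1 / (lam * T)) * ∑ t, deriv ℓ (y t * (w ⬝ᵥ x t)) * y t * x t i := by
    intro i
    have := hw.objective_stationary hs.1 i
    field_simp at this ⊢
    linarith
  have hzz : ∀ p, z p = -(1 / (lam * T)) *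
      ∑ t, deriv ℓ (y t * (z ⬝ᵥ R *ᵥ x t)) * y t * (R *ᵥ x t) p := by
    intro p
    have := hz.objective_stationary hs.1 p
    field_simp at this ⊢
    linarith
  have comb : ∀ (c : Fin T → ℝ) (p : κ),
      (R *ᵥ fun i => -(1 / (lam * T)) * ∑ t, c t * x t i) p =
        -(1 / (lam * T)) * ∑ t, c t * (R *ᵥ x t) p := by
    intro c p
    simp only [Matrix.mulVec, dotProduct, Finset.mul_sum]
    rw [Finset.sum_comm]
    exact Finset.sum_congr rfl fun t _ => Finset.sum_congr rfl fun i _ => by ring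
  have hzv : ∀ p, z p - (R *ᵥ w) p = (R *ᵥ v) p := by
    intro p
    have h1 : (R *ᵥ w) p = -(1 / (lam * T)) *
        ∑ t, deriv ℓ (y t * (w ⬝ᵥ x t)) * y t * (R *ᵥ x t) p := by
      conv_lhs => rw [show w = fun i => -(1 / (lam * T)) *
        ∑ t, deriv ℓ (y t * (w ⬝ᵥ x t)) * y t * x t i from funext hww]
      exact comb _ p
    rw [hzz p, h1, hv, comb, ← mul_sub, ← Finset.sum_sub_distrib]
    simp only [hD, sub_mul]
  set N := ∑ p, (z p - (R *ᵥ w) p) ^ 2 with hN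
  have hN0 : 0 ≤ N := Finset.sum_nonneg fun p _ => sq_nonneg _
  -- co-coercivity, summed
  have hco : ∑ t, D t ^ 2 ≤ β * ∑ t, D t * (z ⬝ᵥ R *ᵥ x t - w ⬝ᵥ x t) := by
    rw [Finset.mul_sum]
    refine Finset.sum_le_sum fun t _ => ?_
    have h := hs.sq_deriv_sub_le hc (y t * (z ⬝ᵥ R *ᵥ x t)) (y t * (w ⬝ᵥ x t))
    have hyt : y t ^ 2 = 1 := by rcases hy t with h | h <;> simp [h]
    simp only [hD]
    calc _ = (deriv ℓ (y t * (z ⬝ᵥ R *ᵥ x t)) - deriv ℓ (y t * (w ⬝ᵥ x t))) ^ 2 := by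
          linear_combination (deriv ℓ (y t * (z ⬝ᵥ R *ᵥ x t)) - deriv ℓ (y t * (w ⬝ᵥ x t))) ^ 2
            * hyt
      _ ≤ _ := h
      _ = _ := by ring
  have hpair : ∑ t, D t * (z ⬝ᵥ R *ᵥ x t - w ⬝ᵥ x t) =
      -(lam * T) * (v ⬝ᵥ (Rᵀ *ᵥ z - w)) := by
    have h1 : ∀ t, z ⬝ᵥ R *ᵥ x t - w ⬝ᵥ x t = (Rᵀ *ᵥ z - w) ⬝ᵥ x t := by
      intro t
      rw [sub_dotProduct, Matrix.dotProduct_mulVec, Matrix.mulVec_transpose]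
    rw [Finset.sum_congr rfl fun t _ => by rw [h1 t]]
    simp only [hv, dotProduct, Finset.mul_sum, Finset.sum_mul]
    rw [Finset.sum_comm]
    refine Finset.sum_congr rfl fun t _ => Finset.sum_congr rfl fun i _ => ?_
    field_simp
  -- Substituting `z = R v + R w` isolates `N = ‖R v‖₂²`; the remainder is the sketching error of
  -- `w` alone.
  have hsplit : v ⬝ᵥ (Rᵀ *ᵥ z - w) = N + v ⬝ᵥ (Rᵀ *ᵥ (R *ᵥ w) - w) := by
    have hz' : z = R *ᵥ v + R *ᵥ w := by
      funext p
      have := hzv p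
      simp only [Pi.add_apply]
      linarith
    have hN' : N = v ⬝ᵥ (Rᵀ *ᵥ (R *ᵥ v)) := by
      rw [Matrix.dotProduct_mulVec, Matrix.vecMul_transpose, hN]
      simp only [hzv, dotProduct, sq]
    rw [hN', ← dotProduct_add]
    congr 1
    conv_lhs => rw [hz']
    rw [Matrix.mulVec_add]
    abel
  set P := (1 / (T : ℝ)) * ∑ t, |D t| with hP
  have hP0 : 0 ≤ P := by positivity
  have hv1 : ∑ i, |v i| ≤ γ / lam * P := by
    calc ∑ i, |v i| ≤ ∑ i, (1 / (lam * T)) * ∑ t, |D t| * |x t i| := by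
          refine Finset.sum_le_sum fun i _ => ?_
          simp only [hv]
          rw [abs_mul, abs_neg, abs_of_pos (by positivity : 0 < 1 / (lam * (T : ℝ)))]
          gcongr
          refine (Finset.abs_sum_le_sum_abs _ _).trans (le_of_eq ?_)
          simp only [abs_mul]
      _ = (1 / (lam * T)) * ∑ t, |D t| * l1Norm (x t) := by
          rw [← Finset.mul_sum, Finset.sum_comm]
          simp only [l1Norm, Finset.mul_sum]
      _ ≤ (1 / (lam * T)) * ∑ t, |D t| * γ := by
          gcongr with t _
          exact hx t
      _ = γ / lam * P := by
          rw [← Finset.sum_mul, hP]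
          field_simp
  have hbound : -(v ⬝ᵥ (Rᵀ *ᵥ (R *ᵥ w) - w)) ≤ γ / lam * P * q := by
    refine (neg_le_abs _).trans ?_
    calc |v ⬝ᵥ (Rᵀ *ᵥ (R *ᵥ w) - w)| ≤ ∑ i, |v i * (Rᵀ *ᵥ (R *ᵥ w) - w) i| :=
          Finset.abs_sum_le_sum_abs _ _
      _ ≤ ∑ i, |v i| * q := by
          refine Finset.sum_le_sum fun i _ => ?_
          rw [abs_mul]
          exact mul_le_mul_of_nonneg_left (hq i) (abs_nonneg _)
      _ ≤ _ := by
          rw [← Finset.sum_mul]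
          exact mul_le_mul_of_nonneg_right hv1 hq0
  have hPsq : T * P ^ 2 ≤ ∑ t, D t ^ 2 := by
    have h := sq_sum_le_card_mul_sum_sq (s := Finset.univ) (f := fun t => |D t|)
    simp only [Finset.card_univ, Fintype.card_fin, sq_abs] at h
    rw [hP]
    calc (T : ℝ) * (1 / T * ∑ t, |D t|) ^ 2 = (1 / T) * (∑ t, |D t|) ^ 2 := by field_simp
      _ ≤ (1 / T) * (T * ∑ t, D t ^ 2) := by gcongr
      _ = _ := by field_simp
  have hβ := hs.nonneg_of_convexOn hc
  have hkey : P ^ 2 + β * lam * N ≤ β * (γ * P * q) := by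
    have h1 : T * P ^ 2 ≤ β * (-(lam * T) * (N + v ⬝ᵥ (Rᵀ *ᵥ (R *ᵥ w) - w))) := by
      rw [← hsplit, ← hpair]
      exact hPsq.trans hco
    have h2 : β * (lam * T) * (-(v ⬝ᵥ (Rᵀ *ᵥ (R *ᵥ w) - w))) ≤
        β * (lam * T) * (γ / lam * P * q) := by gcongr
    have h3 : β * (lam * T) * (γ / lam * P * q) = T * (β * (γ * P * q)) := by field_simp
    have h4 : T * (P ^ 2 + β * lam * N) ≤ T * (β * (γ * P * q)) := by linarith
    exact le_of_mul_le_mul_left h4 hT'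
  rcases hβ.eq_or_lt with h0 | hpos
  -- For `β = 0` the key inequality no longer sees `N`, but it forces `P = 0`, hence `v = 0`.
  · have hPz : P = 0 := by
      rw [← h0] at hkey
      nlinarith
    have hvz : ∀ i, v i = 0 := by
      intro i
      have h1 : |v i| ≤ ∑ i, |v i| :=
        Finset.single_le_sum (f := fun i => |v i|) (fun _ _ => abs_nonneg _) (Finset.mem_univ i)
      rw [hPz, mul_zero] at hv1
      exact abs_eq_zero.1 (le_antisymm (h1.trans hv1) (abs_nonneg _))
    have hv0 : v = 0 := funext hvz
    have : N = 0 := by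
      rw [hN]
      simp [hzv, hv0]
    rw [this, ← h0]
    simp
  -- The factor `1/4` is the maximum of `βγqP - P²` over `P`, attained at `P = βγq/2`.
  · have h1 : β * lam * N ≤ β * (β * γ ^ 2 * (q ^ 2 / 4)) := by
      nlinarith [sq_nonneg (P - β * γ * q / 2)]
    have h2 : lam * N ≤ β * γ ^ 2 * (q ^ 2 / 4) := by
      rw [mul_assoc] at h1
      exact le_of_mul_le_mul_left h1 hpos
    rw [div_mul_eq_mul_div, le_div_iff₀ hlam]
    linarith

/-! ### Robustness of medians -/

/-- A median is close to `a` as soon as more than half of the values are. -/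
theorem IsMedian.abs_sub_le {s : ℕ} {v : Fin s → ℝ} {m a τ : ℝ} (hm : IsMedian v m)
    (h : 2 * (Finset.univ.filter fun j => τ < |v j - a|).card < s) : |m - a| ≤ τ := by
  by_contra! hcon
  rcases lt_abs.1 hcon with hlt | hlt
  · have hsub : (Finset.univ.filter fun j => m ≤ v j) ⊆
        Finset.univ.filter fun j => τ < |v j - a| := by
      intro j
      simp only [Finset.mem_filter, Finset.mem_univ, true_and]
      exact fun hj => lt_abs.2 (Or.inl (by linarith))
    have := Finset.card_le_card hsub
    have := hm.2
    omega
  · have hsub : (Finset.univ.filter fun j => v j ≤ m) ⊆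
        Finset.univ.filter fun j => τ < |v j - a| := by
      intro j
      simp only [Finset.mem_filter, Finset.mem_univ, true_and]
      exact fun hj => lt_abs.2 (Or.inr (by linarith))
    have := Finset.card_le_card hsub
    have := hm.1
    omega

/-! ### Moments of a single row, by symmetries of the hashing -/

/-- The buckets and sign bits of a single Count-Sketch row. -/
abbrev RowHashing (b d : ℕ) : Type := (Fin d → Fin b) × (Fin d → Bool)

namespace RowHashing

variable {b d : ℕ}

/-- The sign of an index in a single row. -/
noncomputable def sign (ω : RowHashing b d) (i : Fin d) : ℝ := if ω.2 i then 1 else -1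

/-- The signed collision indicator of two indices. -/
noncomputable def overlap (ω : RowHashing b d) (i i' : Fin d) : ℝ :=
  if ω.1 i' = ω.1 i then ω.sign i * ω.sign i' else 0

/-- The error of the estimate of `w i` by its bucket in a single row. -/
noncomputable def error (ω : RowHashing b d) (w : Fin d → ℝ) (i : Fin d) : ℝ :=
  ∑ i' ∈ Finset.univ.erase i, ω.overlap i i' * w i'

theorem sign_mul_self (ω : RowHashing b d) (i : Fin d) : ω.sign i * ω.sign i = 1 := by
  unfold sign
  split_ifs <;> norm_num

theorem abs_sign (ω : RowHashing b d) (i : Fin d) : |ω.sign i| = 1 := by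
  unfold sign
  split_ifs <;> norm_num

theorem abs_overlap_le (ω : RowHashing b d) (i i' : Fin d) : |ω.overlap i i'| ≤ 1 := by
  unfold overlap
  split_ifs
  · rw [abs_mul, abs_sign, abs_sign, one_mul]
  · simp

theorem abs_error_le (ω : RowHashing b d) (w : Fin d → ℝ) (i : Fin d) :
    |ω.error w i| ≤ l1Norm w := by
  unfold error l1Norm
  calc _ ≤ ∑ i' ∈ Finset.univ.erase i, |ω.overlap i i' * w i'| :=
        Finset.abs_sum_le_sum_abs _ _
    _ ≤ ∑ i' ∈ Finset.univ.erase i, |w i'| := by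
        refine Finset.sum_le_sum fun i' _ => ?_
        rw [abs_mul]
        exact mul_le_of_le_one_left (abs_nonneg _) (ω.abs_overlap_le i i')
    _ ≤ _ := Finset.sum_le_sum_of_subset_of_nonneg (Finset.erase_subset _ _)
        fun _ _ _ => abs_nonneg _

/-- Flipping the sign bit of one index. -/
def flip (k : Fin d) : RowHashing b d ≃ RowHashing b d :=
  Function.Involutive.toPerm (fun ω => (ω.1, Function.update ω.2 k (!ω.2 k))) fun ω => by
    ext <;> simp

theorem sign_flip_self (k : Fin d) (ω : RowHashing b d) : (flip k ω).sign k = -ω.sign k := by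
  have : (flip k ω).2 k = !ω.2 k := Function.update_self ..
  unfold sign
  rw [this]
  cases ω.2 k <;> simp

theorem sign_flip_of_ne {k i : Fin d} (h : i ≠ k) (ω : RowHashing b d) :
    (flip k ω).sign i = ω.sign i := by
  have : (flip k ω).2 i = ω.2 i := Function.update_of_ne h ..
  unfold sign
  rw [this]

theorem overlap_flip_right {i i' : Fin d} (h : i ≠ i') (ω : RowHashing b d) :
    (flip i' ω).overlap i i' = -ω.overlap i i' := by
  have : (flip i' ω).1 = ω.1 := rfl
  unfold overlap
  rw [this, sign_flip_self, sign_flip_of_ne h]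
  split_ifs <;> ring

theorem overlap_flip_of_ne {i i' k : Fin d} (h : i ≠ k) (h' : i' ≠ k) (ω : RowHashing b d) :
    (flip k ω).overlap i i' = ω.overlap i i' := by
  have : (flip k ω).1 = ω.1 := rfl
  unfold overlap
  rw [this, sign_flip_of_ne h, sign_flip_of_ne h']

/-- The signed collision indicator is subgaussian. -/
theorem sum_exp_overlap_le {i i' : Fin d} (h : i ≠ i') (r : ℝ) :
    ∑ ω : RowHashing b d, Real.exp (r * ω.overlap i i') ≤
      Fintype.card (RowHashing b d) * Real.exp (r ^ 2 / 2) := by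
  have h1 : ∑ ω : RowHashing b d, Real.exp (r * ω.overlap i i') =
      ∑ ω : RowHashing b d, Real.exp (-(r * ω.overlap i i')) := by
    rw [← Equiv.sum_comp (flip i')]
    simp only [overlap_flip_right h, mul_neg]
  have h2 : ∑ ω : RowHashing b d, Real.exp (r * ω.overlap i i') =
      ∑ ω : RowHashing b d, Real.cosh (r * ω.overlap i i') := by
    simp only [Real.cosh_eq]
    rw [← Finset.sum_div, Finset.sum_add_distrib, ← h1]
    ring
  rw [h2, ← nsmul_eq_mul, ← Finset.card_univ]
  refine Finset.sum_le_card_nsmul _ _ _ fun ω _ => ?_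
  refine (Real.cosh_le_exp_half_sq _).trans (Real.exp_le_exp.2 ?_)
  have := sq_le_one_iff_abs_le_one _ |>.2 (ω.abs_overlap_le i i')
  rw [mul_pow]
  nlinarith [sq_nonneg r]

/-- Flipping the sign bit of `k` permutes the rows and negates the summand, since `k` differs from
both `i` and `l`. -/
theorem sum_overlap_mul_overlap {i k l : Fin d} (hk : i ≠ k) (hl : l ≠ k) :
    ∑ ω : RowHashing b d, ω.overlap i k * ω.overlap i l = 0 := by
  have h : ∑ ω : RowHashing b d, ω.overlap i k * ω.overlap i l =
      ∑ ω : RowHashing b d, -(ω.overlap i k * ω.overlap i l) := by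
    rw [← Equiv.sum_comp (flip k)]
    simp only [overlap_flip_right hk, overlap_flip_of_ne hk hl, neg_mul]
  rw [Finset.sum_neg_distrib] at h
  linarith

/-- Cyclically shifting the bucket of one index. -/
def shift [NeZero b] (k : Fin d) (c : Fin b) : RowHashing b d ≃ RowHashing b d where
  toFun ω := (Function.update ω.1 k (ω.1 k + c), ω.2)
  invFun ω := (Function.update ω.1 k (ω.1 k - c), ω.2)
  left_inv ω := by simp
  right_inv ω := by simp

/-- Of the `b` cyclic shifts of the bucket of `k`, exactly one makes it collide with `i`. -/
theorem sum_overlap_sq [NeZero b] {i k : Fin d} (hk : i ≠ k) :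
    ∑ ω : RowHashing b d, ω.overlap i k ^ 2 = Fintype.card (RowHashing b d) / b := by
  have h0 : ∀ ω : RowHashing b d, ω.overlap i k ^ 2 = if ω.1 k = ω.1 i then 1 else 0 := by
    intro ω
    unfold overlap
    split_ifs
    · rw [mul_pow, sq, sq, sign_mul_self, sign_mul_self, one_mul]
    · simp
  have h1 : ∀ c : Fin b, ∑ ω : RowHashing b d, ω.overlap i k ^ 2 =
      ∑ ω : RowHashing b d, if ω.1 k + c = ω.1 i then (1 : ℝ) else 0 := by
    intro c
    rw [← Equiv.sum_comp (shift k c)]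
    refine Finset.sum_congr rfl fun ω _ => ?_
    rw [h0]
    simp [shift, hk]
  have h2 : (b : ℝ) * ∑ ω : RowHashing b d, ω.overlap i k ^ 2 =
      Fintype.card (RowHashing b d) := by
    calc _ = ∑ c : Fin b, ∑ ω : RowHashing b d, ω.overlap i k ^ 2 := by simp
      _ = ∑ c : Fin b, ∑ ω : RowHashing b d, if ω.1 k + c = ω.1 i then (1 : ℝ) else 0 :=
          Finset.sum_congr rfl fun c _ => h1 c
      _ = ∑ ω : RowHashing b d, 1 := by
          rw [Finset.sum_comm]
          refine Finset.sum_congr rfl fun ω _ => ?_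
          simp only [← eq_sub_iff_add_eq']
          simp
      _ = _ := by simp
  have hb : (b : ℝ) ≠ 0 := Nat.cast_ne_zero.2 (NeZero.ne b)
  rw [eq_div_iff hb, mul_comm, h2]

/-- Cross terms cancel by sign symmetry and each diagonal term has weight `1/b`, so the second
moment is at most `‖w‖₂²/b`; then `‖w‖₂ ≤ ‖w‖₁`. -/
theorem sum_error_sq_le [NeZero b] (w : Fin d → ℝ) (i : Fin d) :
    ∑ ω : RowHashing b d, ω.error w i ^ 2 ≤
      Fintype.card (RowHashing b d) / b * l1Norm w ^ 2 := by
  have h1 : ∑ ω : RowHashing b d, ω.error w i ^ 2 =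
      ∑ k ∈ Finset.univ.erase i, Fintype.card (RowHashing b d) / b * w k ^ 2 := by
    simp only [error, sq, Finset.sum_mul_sum]
    rw [Finset.sum_comm]
    refine Finset.sum_congr rfl fun k hk => ?_
    have hik : i ≠ k := (Finset.ne_of_mem_erase hk).symm
    rw [Finset.sum_comm, Finset.sum_eq_single_of_mem k hk]
    · rw [← sum_overlap_sq hik, Finset.sum_mul]
      exact Finset.sum_congr rfl fun ω _ => by ring
    · intro l _ hlk
      calc _ = (∑ ω : RowHashing b d, ω.overlap i k * ω.overlap i l) * (w k * w l) := by
            rw [Finset.sum_mul]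
            exact Finset.sum_congr rfl fun ω _ => by ring
        _ = 0 := by rw [sum_overlap_mul_overlap hik hlk, zero_mul]
  rw [h1, ← Finset.mul_sum]
  gcongr
  calc ∑ k ∈ Finset.univ.erase i, w k ^ 2 ≤ ∑ k, |w k| ^ 2 := by
        simp only [sq_abs]
        exact Finset.sum_le_sum_of_subset_of_nonneg (Finset.erase_subset _ _)
          fun _ _ _ => sq_nonneg _
    _ ≤ _ := Finset.sum_sq_le_sq_sum_of_nonneg fun _ _ => abs_nonneg _

end RowHashing

/-! ### Tail and union bounds by counting -/

/-- Markov's inequality for counting. -/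
theorem card_filter_mul_le_sum {Ω : Type*} [Fintype Ω] {p : Ω → Prop} [DecidablePred p]
    {F : Ω → ℝ} {a : ℝ} (hF : ∀ ω, 0 ≤ F ω) (h : ∀ ω, p ω → a ≤ F ω) :
    ((Finset.univ.filter p).card : ℝ) * a ≤ ∑ ω, F ω := by
  rw [← nsmul_eq_mul]
  calc _ ≤ ∑ ω ∈ Finset.univ.filter p, F ω :=
        Finset.card_nsmul_le_sum _ _ _ fun ω hω => h ω (Finset.mem_filter.1 hω).2
    _ ≤ _ := Finset.sum_le_sum_of_subset_of_nonneg (Finset.filter_subset _ _) fun ω _ _ => hF ω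

/-- The Chernoff bound for sums of independent copies of a subgaussian variable. -/
theorem card_filter_lt_sum_le {Ω : Type*} [Fintype Ω] {s : ℕ} {X : Ω → ℝ} {a : ℝ} (ha : 0 ≤ a)
    (hX : ∀ r : ℝ, ∑ ω, Real.exp (r * X ω) ≤ Fintype.card Ω * Real.exp (r ^ 2 / 2)) :
    ((Finset.univ.filter fun H : Fin s → Ω => s * a < ∑ j, X (H j)).card : ℝ) ≤
      Fintype.card (Fin s → Ω) * Real.exp (-(s * a ^ 2 / 2)) := by
  have h1 := card_filter_mul_le_sum (p := fun H : Fin s → Ω => s * a < ∑ j, X (H j))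
    (F := fun H => Real.exp (a * ∑ j, X (H j))) (a := Real.exp (a * (s * a)))
    (fun _ => (Real.exp_pos _).le)
    fun H hH => Real.exp_le_exp.2 (mul_le_mul_of_nonneg_left hH.le ha)
  have h2 : ∑ H : Fin s → Ω, Real.exp (a * ∑ j, X (H j)) ≤
      Fintype.card (Fin s → Ω) * Real.exp (s * (a ^ 2 / 2)) := by
    calc _ = (∑ ω, Real.exp (a * X ω)) ^ s := by
          simp only [Finset.mul_sum, Real.exp_sum]
          rw [Fintype.sum_pow]
      _ ≤ (Fintype.card Ω * Real.exp (a ^ 2 / 2)) ^ s :=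
          pow_le_pow_left₀ (Finset.sum_nonneg fun _ _ => (Real.exp_pos _).le) (hX a) s
      _ = _ := by
          rw [mul_pow, ← Real.exp_nat_mul, Fintype.card_fun, Fintype.card_fin]
          push_cast
          rfl
  have h3 := h1.trans h2
  rw [← le_div_iff₀ (Real.exp_pos _), mul_div_assoc, ← Real.exp_sub] at h3
  refine h3.trans_eq ?_
  congr 2
  ring

theorem card_filter_lt_abs_sum_le {Ω : Type*} [Fintype Ω] {s : ℕ} {X : Ω → ℝ} {a : ℝ}
    (ha : 0 ≤ a)
    (hX : ∀ r : ℝ, ∑ ω, Real.exp (r * X ω) ≤ Fintype.card Ω * Real.exp (r ^ 2 / 2)) :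
    ((Finset.univ.filter fun H : Fin s → Ω => s * a < |∑ j, X (H j)|).card : ℝ) ≤
      Fintype.card (Fin s → Ω) * (2 * Real.exp (-(s * a ^ 2 / 2))) := by
  classical
  have h1 := card_filter_lt_sum_le (s := s) ha hX
  have h2 := card_filter_lt_sum_le (s := s) (X := fun ω => -X ω) ha fun r => by
    simpa using hX (-r)
  have h3 : (Finset.univ.filter fun H : Fin s → Ω => s * a < |∑ j, X (H j)|) ⊆
      (Finset.univ.filter fun H : Fin s → Ω => s * a < ∑ j, X (H j)) ∪
        Finset.univ.filter fun H : Fin s → Ω => s * a < ∑ j, -X (H j) := by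
    intro H
    simp [lt_abs]
  have h4 : ((Finset.univ.filter fun H : Fin s → Ω => s * a < |∑ j, X (H j)|).card : ℝ) ≤
      (Finset.univ.filter fun H : Fin s → Ω => s * a < ∑ j, X (H j)).card +
        (Finset.univ.filter fun H : Fin s → Ω => s * a < ∑ j, -X (H j)).card := by
    exact_mod_cast (Finset.card_le_card h3).trans (Finset.card_union_le _ _)
  linarith

/-- A rare event seldom occurs in more than a quarter of independent trials. -/
theorem card_filter_lt_four_mul_card_le {Ω : Type*} [Fintype Ω] {s : ℕ} {p : Ω → Prop}
    [DecidablePred p]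
    (hp : 30 * ((Finset.univ.filter p).card : ℝ) ≤ Fintype.card Ω) :
    ((Finset.univ.filter fun H : Fin s → Ω =>
      s < 4 * (Finset.univ.filter fun j => p (H j)).card).card : ℝ) ≤
      Fintype.card (Fin s → Ω) * (3 / 4) ^ s := by
  -- Weight `16 = 2 ^ 4` per occurrence makes the product at least `2 ^ s` on the event. The mean
  -- weight of one trial is at most `1 + 15/30 = 3/2`, which leaves the ratio `3/4`.
  have h1 := card_filter_mul_le_sum (p := fun H : Fin s → Ω =>
      s < 4 * (Finset.univ.filter fun j => p (H j)).card)
    (F := fun H => ∏ j, if p (H j) then (16 : ℝ) else 1) (a := 2 ^ s)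
    (fun _ => Finset.prod_nonneg fun _ _ => by split_ifs <;> norm_num)
    fun H hH => by
      rw [Finset.prod_ite, Finset.prod_const, Finset.prod_const_one, mul_one,
        show (16 : ℝ) = 2 ^ 4 by norm_num, ← pow_mul]
      exact pow_le_pow_right₀ (by norm_num) hH.le
  have h2 : ∑ H : Fin s → Ω, ∏ j, (if p (H j) then (16 : ℝ) else 1) ≤
      Fintype.card (Fin s → Ω) * (3 / 2) ^ s := by
    rw [← Fintype.sum_pow (fun ω => if p ω then (16 : ℝ) else 1)]
    have h3 : ∑ ω, (if p ω then (16 : ℝ) else 1) =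
        Fintype.card Ω + 15 * (Finset.univ.filter p).card := by
      have : ∀ ω, (if p ω then (16 : ℝ) else 1) = 1 + 15 * if p ω then 1 else 0 := by
        intro ω
        split_ifs <;> norm_num
      simp only [this, Finset.sum_add_distrib, ← Finset.mul_sum, Finset.sum_boole]
      simp
    rw [h3, Fintype.card_fun, Fintype.card_fin]
    push_cast
    rw [← mul_pow]
    exact pow_le_pow_left₀ (by positivity) (by linarith) s
  have h3 := h1.trans h2
  rw [← le_div_iff₀ (by positivity), mul_div_assoc, ← div_pow] at h3
  refine h3.trans_eq ?_
  norm_num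

/-- The union bound for counting. -/
theorem card_filter_le_card_mul {Ω ι : Type*} [Fintype Ω] {I : Finset ι} {q : Ω → Prop}
    {p : ι → Ω → Prop} [∀ i, DecidablePred (p i)] [DecidablePred q] {c : ℝ}
    (hq : ∀ ω, q ω → ∃ i ∈ I, p i ω)
    (h : ∀ i ∈ I, ((Finset.univ.filter (p i)).card : ℝ) ≤ c) :
    ((Finset.univ.filter q).card : ℝ) ≤ I.card * c := by
  classical
  have h1 : Finset.univ.filter q ⊆ I.biUnion fun i => Finset.univ.filter (p i) := by
    intro ω hω
    simpa using hq ω (Finset.mem_filter.1 hω).2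
  rw [← nsmul_eq_mul]
  refine le_trans ?_ (Finset.sum_le_card_nsmul I _ c h)
  exact_mod_cast (Finset.card_le_card h1).trans Finset.card_biUnion_le

theorem one_sub_le_uniformOn_univ_real {Ω : Type*} [Fintype Ω] [Nonempty Ω] [MeasurableSpace Ω]
    [MeasurableSingletonClass Ω] {S : Set Ω} {B : Finset Ω} {δ : ℝ}
    (hB : (B.card : ℝ) ≤ δ * Fintype.card Ω) (hS : ∀ ω, ω ∉ B → ω ∈ S) :
    1 - δ ≤ (ProbabilityTheory.uniformOn (Set.univ : Set Ω)).real S := by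
  classical
  have hpos : (0 : ℝ) < Fintype.card Ω := by exact_mod_cast Fintype.card_pos
  have h1 : (ProbabilityTheory.uniformOn (Set.univ : Set Ω)).real (B : Set Ω) ≤ δ := by
    rw [MeasureTheory.measureReal_def, ProbabilityTheory.uniformOn_univ,
      MeasureTheory.Measure.count_apply_finset, ENNReal.toReal_div]
    simpa [div_le_iff₀ hpos] using hB
  have h2 : (ProbabilityTheory.uniformOn (Set.univ : Set Ω)).real (B : Set Ω)ᶜ ≤
      (ProbabilityTheory.uniformOn (Set.univ : Set Ω)).real S :=
    MeasureTheory.measureReal_mono fun ω hω => hS ω (by simpa using hω)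
  rw [MeasureTheory.probReal_compl_eq_one_sub B.measurableSet] at h2
  linarith

/-! ### Recovery from the full sketch -/

namespace Hashing

variable {s b d : ℕ}

/-- The hashing data of a single row. -/
def row (H : Hashing s b d) (j : Fin s) : RowHashing b d := (H.1 j, H.2 j)

/-- A hashing is a family of independent rows. -/
def equivRows : Hashing s b d ≃ (Fin s → RowHashing b d) where
  toFun := row
  invFun r := (fun j => (r j).1, fun j => (r j).2)
  left_inv _ := rfl
  right_inv _ := rfl

theorem sign_mul_countSketch_mulVec (H : Hashing s b d) (w : Fin d → ℝ) (j : Fin s) (i : Fin d) :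
    H.sign j i * (countSketchMatrix H *ᵥ w) (j, H.1 j i) = w i + (H.row j).error w i := by
  have h1 : H.sign j i * (countSketchMatrix H *ᵥ w) (j, H.1 j i) =
      ∑ i', (H.row j).overlap i i' * w i' := by
    simp only [Matrix.mulVec, dotProduct, Finset.mul_sum]
    refine Finset.sum_congr rfl fun i' _ => ?_
    have h2 : countSketchMatrix H (j, H.1 j i) i' =
        if H.1 j i' = H.1 j i then H.sign j i' else 0 := rfl
    have h3 : (H.row j).overlap i i' =
        if H.1 j i' = H.1 j i then H.sign j i * H.sign j i' else 0 := rfl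
    rw [h2, h3, ← mul_assoc, mul_ite, mul_zero]
  rw [h1, ← Finset.add_sum_erase _ _ (Finset.mem_univ i), RowHashing.error]
  congr 1
  simp [RowHashing.overlap, RowHashing.sign_mul_self]

/-- Applying `Rᵀ` to `R w` averages the `s` single-row estimates of each coordinate. -/
theorem transpose_mulVec_mulVec (H : Hashing s b d) (hs : 0 < s) (w : Fin d → ℝ) (i : Fin d) :
    ((scaledCountSketchMatrix H)ᵀ *ᵥ (scaledCountSketchMatrix H *ᵥ w)) i - w i =
      (1 / (s : ℝ)) * ∑ j, (H.row j).error w i := by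
  have hs' : (0 : ℝ) < s := by exact_mod_cast hs
  have h1 : ((countSketchMatrix H)ᵀ *ᵥ (countSketchMatrix H *ᵥ w)) i =
      ∑ j, (w i + (H.row j).error w i) := by
    simp only [← sign_mul_countSketch_mulVec]
    rw [Matrix.mulVec, dotProduct, Fintype.sum_prod_type]
    refine Finset.sum_congr rfl fun j _ => ?_
    simp [countSketchMatrix]
  have h2 : (1 / √(s : ℝ)) * (1 / √(s : ℝ)) = 1 / s := by
    rw [div_mul_div_comm, Real.mul_self_sqrt hs'.le, one_mul]
  rw [scaledCountSketchMatrix, Matrix.transpose_smul, Matrix.smul_mulVec, Matrix.smul_mulVec,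
    Matrix.mulVec_smul, smul_smul, h2, Pi.smul_apply, h1, Finset.sum_add_distrib]
  simp
  field_simp
  ring

/-- The diagonal of `RᵀR` is exactly `1`, so a bound on the off-diagonal entries pairs with `‖w‖₁`.
-/
theorem abs_transpose_mulVec_mulVec_sub_le (H : Hashing s b d) (hs : 0 < s) (w : Fin d → ℝ)
    {a : ℝ} (ha : 0 ≤ a)
    (h : ∀ i i', i ≠ i' → |∑ j, (H.row j).overlap i i'| ≤ s * a) (i : Fin d) :
    |((scaledCountSketchMatrix H)ᵀ *ᵥ (scaledCountSketchMatrix H *ᵥ w)) i - w i| ≤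
      a * l1Norm w := by
  have hs' : (0 : ℝ) < s := by exact_mod_cast hs
  rw [transpose_mulVec_mulVec H hs, abs_mul, abs_of_pos (by positivity), one_div,
    inv_mul_le_iff₀ hs']
  have h1 : ∑ j, (H.row j).error w i =
      ∑ i' ∈ Finset.univ.erase i, (∑ j, (H.row j).overlap i i') * w i' := by
    simp only [RowHashing.error, Finset.sum_mul]
    rw [Finset.sum_comm]
  rw [h1]
  calc _ ≤ ∑ i' ∈ Finset.univ.erase i, |(∑ j, (H.row j).overlap i i') * w i'| :=
        Finset.abs_sum_le_sum_abs _ _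
    _ ≤ ∑ i' ∈ Finset.univ.erase i, s * a * |w i'| := by
        refine Finset.sum_le_sum fun i' hi' => ?_
        rw [abs_mul]
        exact mul_le_mul_of_nonneg_right (h i i' (Finset.ne_of_mem_erase hi').symm) (abs_nonneg _)
    _ ≤ ∑ i', s * a * |w i'| :=
        Finset.sum_le_sum_of_subset_of_nonneg (Finset.erase_subset _ _)
          fun _ _ _ => by positivity
    _ = _ := by
        rw [← Finset.mul_sum, l1Norm]
        ring

/-- Count-Sketch recovery tolerates an `ℓ₂` perturbation of the sketch. -/
theorem recovery_error_le (H : Hashing s b d) (hs : 0 < s) {w : Fin d → ℝ}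
    {z : Fin s × Fin b → ℝ} {west : Fin d → ℝ} {τ : ℝ} (hτ : 0 ≤ τ)
    (hz : ∑ p, (z p - (scaledCountSketchMatrix H *ᵥ w) p) ^ 2 ≤ τ ^ 2 / 4)
    (herr : ∀ i, 4 * (Finset.univ.filter fun j => τ < |(H.row j).error w i|).card ≤ s)
    (hw : IsCountSketchRecovery H z west) (i : Fin d) : |w i - west i| ≤ 2 * τ := by
  classical
  have hs' : (0 : ℝ) < s := by exact_mod_cast hs
  set e : Fin s × Fin b → ℝ := fun p => z p - (scaledCountSketchMatrix H *ᵥ w) p with he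
  have hval : ∀ j, √(s : ℝ) * H.sign j i * z (j, H.1 j i) - w i =
      √(s : ℝ) * (H.sign j i * e (j, H.1 j i)) + (H.row j).error w i := by
    intro j
    have h1 := sign_mul_countSketch_mulVec H w j i
    have h2 : (scaledCountSketchMatrix H *ᵥ w) (j, H.1 j i) =
        1 / √(s : ℝ) * (countSketchMatrix H *ᵥ w) (j, H.1 j i) := by
      rw [scaledCountSketchMatrix, Matrix.smul_mulVec]
      rfl
    have h3 : √(s : ℝ) * (1 / √(s : ℝ)) = 1 := by
      have : √(s : ℝ) ≠ 0 := (Real.sqrt_pos.2 hs').ne'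
      field_simp
    simp only [he]
    rw [h2]
    linear_combination h1 + H.sign j i * (countSketchMatrix H *ᵥ w) (j, H.1 j i) * h3
  set B := Finset.univ.filter fun j => τ ^ 2 < s * e (j, H.1 j i) ^ 2 with hB
  -- Each row in `B` contributes more than `τ²` to a sum of at most `s τ²/4`. Together with a
  -- quarter of the rows lost to `error`, this leaves strictly fewer than half bad, as the median
  -- requires.
  have hBcard : B.card ≠ 0 → 4 * B.card < s := by
    intro hne
    have hBne : B.Nonempty := Finset.card_ne_zero.1 hne
    have h1 : (B.card : ℝ) * τ ^ 2 < ∑ j ∈ B, s * e (j, H.1 j i) ^ 2 := by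
      rw [← nsmul_eq_mul, ← Finset.sum_const]
      exact Finset.sum_lt_sum_of_nonempty hBne fun j hj => (Finset.mem_filter.1 hj).2
    have h2 : ∑ j ∈ B, s * e (j, H.1 j i) ^ 2 ≤ s * (τ ^ 2 / 4) := by
      rw [← Finset.mul_sum]
      refine mul_le_mul_of_nonneg_left (le_trans ?_ hz) hs'.le
      rw [Fintype.sum_prod_type]
      calc _ ≤ ∑ j, e (j, H.1 j i) ^ 2 :=
            Finset.sum_le_sum_of_subset_of_nonneg (Finset.subset_univ _)
              fun _ _ _ => sq_nonneg _
        _ ≤ _ := Finset.sum_le_sum fun j _ =>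
            Finset.single_le_sum (f := fun c => e (j, c) ^ 2) (fun _ _ => sq_nonneg _)
              (Finset.mem_univ _)
    by_contra! hcon
    have h3 : (s : ℝ) ≤ 4 * B.card := by exact_mod_cast hcon
    nlinarith [sq_nonneg τ]
  have hmed := (hw i).abs_sub_le (a := w i) (τ := 2 * τ) ?_
  · rwa [abs_sub_comm]
  · have hsub : (Finset.univ.filter fun j =>
        2 * τ < |√(s : ℝ) * H.sign j i * z (j, H.1 j i) - w i|) ⊆
        B ∪ Finset.univ.filter fun j => τ < |(H.row j).error w i| := by
      intro j hj
      rw [Finset.mem_filter, hval] at hj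
      rw [Finset.mem_union]
      by_contra! hcon
      simp only [hB, Finset.mem_filter, Finset.mem_univ, true_and, not_lt] at hcon
      have h1 : |√(s : ℝ) * (H.sign j i * e (j, H.1 j i))| ≤ τ := by
        refine abs_le_of_sq_le_sq ?_ hτ
        have : H.sign j i ^ 2 = 1 := by
          rw [sq]
          exact (H.row j).sign_mul_self i
        rw [mul_pow, mul_pow, this, one_mul, Real.sq_sqrt hs'.le]
        exact hcon.1
      have := abs_add_le (√(s : ℝ) * (H.sign j i * e (j, H.1 j i))) ((H.row j).error w i)
      linarith [hj.2, hcon.2]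
    have h1 := (Finset.card_le_card hsub).trans (Finset.card_union_le _ _)
    have h2 := herr i
    have h3 := hBcard
    by_cases h : B.card = 0
    · omega
    · have := h3 h
      omega

end Hashing

/-! ### Counting the bad hashings -/

namespace RowHashing

variable {b d : ℕ}

/-- Chebyshev: the bad fraction is at most `4 / (b ε²) ≤ 1/30`. The case `‖w‖₁ = 0` is separate
because the threshold vanishes. -/
theorem thirty_mul_card_filter_error_le (w : Fin d → ℝ) (i : Fin d) {ε : ℝ} (hε : 0 < ε)
    (hb : 120 ≤ b * ε ^ 2) :
    30 * ((Finset.univ.filter fun ω : RowHashing b d =>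
      ε / 2 * l1Norm w < |ω.error w i|).card : ℝ) ≤ Fintype.card (RowHashing b d) := by
  have hbpos : (0 : ℝ) < b := by
    by_contra! h
    nlinarith [sq_nonneg ε]
  have : NeZero b := ⟨by rintro rfl; simp at hbpos⟩
  have hw0 : 0 ≤ l1Norm w := Finset.sum_nonneg fun _ _ => abs_nonneg _
  rcases hw0.eq_or_lt with h0 | hwpos
  · have : (Finset.univ.filter fun ω : RowHashing b d =>
        ε / 2 * l1Norm w < |ω.error w i|) = ∅ := by
      rw [Finset.filter_eq_empty_iff]
      intro ω _
      rw [not_lt]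
      have := ω.abs_error_le w i
      rw [← h0] at this ⊢
      simpa using this
    rw [this]
    simp
  · have h1 := (card_filter_mul_le_sum
      (p := fun ω : RowHashing b d => ε / 2 * l1Norm w < |ω.error w i|)
      (F := fun ω => ω.error w i ^ 2) (a := (ε / 2 * l1Norm w) ^ 2) (fun _ => sq_nonneg _)
      fun ω hω => by
        rw [← sq_abs (ω.error w i)]
        exact pow_le_pow_left₀ (by positivity) hω.le 2).trans (sum_error_sq_le w i)
    set n : ℝ := ((Finset.univ.filter fun ω : RowHashing b d =>
      ε / 2 * l1Norm w < |ω.error w i|).card : ℝ)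
    have hn : 0 ≤ n := Nat.cast_nonneg _
    rw [mul_pow, ← mul_assoc] at h1
    have h2 := le_of_mul_le_mul_right h1 (by positivity)
    rw [le_div_iff₀ hbpos] at h2
    nlinarith

end RowHashing

namespace Hashing

variable {s b d : ℕ}

theorem card_filter_eq_card_filter_rows {q : Hashing s b d → Prop} [DecidablePred q]
    {p : (Fin s → RowHashing b d) → Prop} [DecidablePred p] (h : ∀ H, q H ↔ p H.row) :
    (Finset.univ.filter q).card = (Finset.univ.filter p).card :=
  Finset.card_equiv equivRows fun H => by
    rw [Finset.mem_filter, Finset.mem_filter, h]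
    simp only [Finset.mem_univ]
    rfl

theorem card_rows : Fintype.card (Fin s → RowHashing b d) = Fintype.card (Hashing s b d) :=
  (Fintype.card_congr equivRows).symm

/-- Union bound over at most `d²` pairs of the two-sided Chernoff bound. -/
theorem card_filter_overlap_le {a : ℝ} (ha : 0 ≤ a) :
    ((Finset.univ.filter fun H : Hashing s b d =>
      ∃ i i', i ≠ i' ∧ s * a < |∑ j, (H.row j).overlap i i'|).card : ℝ) ≤
      Fintype.card (Hashing s b d) * (2 * d ^ 2 * Real.exp (-(s * a ^ 2 / 2))) := by
  have hI : ((Finset.univ.filter fun q : Fin d × Fin d => q.1 ≠ q.2).card : ℝ) ≤ d ^ 2 := by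
    have := Finset.card_filter_le (Finset.univ : Finset (Fin d × Fin d)) fun q => q.1 ≠ q.2
    rw [Finset.card_univ, Fintype.card_prod, Fintype.card_fin, ← sq] at this
    exact_mod_cast this
  rw [card_filter_eq_card_filter_rows (p := fun r : Fin s → RowHashing b d =>
    ∃ i i', i ≠ i' ∧ s * a < |∑ j, (r j).overlap i i'|) fun _ => Iff.rfl, ← card_rows]
  have h := card_filter_le_card_mul
    (I := Finset.univ.filter fun q : Fin d × Fin d => q.1 ≠ q.2)
    (q := fun r : Fin s → RowHashing b d =>
      ∃ i i', i ≠ i' ∧ s * a < |∑ j, (r j).overlap i i'|)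
    (p := fun q r => s * a < |∑ j, (r j).overlap q.1 q.2|)
    (fun r ⟨i, i', hne, h⟩ => ⟨(i, i'), by simpa using hne, h⟩)
    (c := Fintype.card (Fin s → RowHashing b d) * (2 * Real.exp (-(s * a ^ 2 / 2))))
    fun q hq => by
      convert card_filter_lt_abs_sum_le (X := fun ω : RowHashing b d => ω.overlap q.1 q.2) ha
        (RowHashing.sum_exp_overlap_le (Finset.mem_filter.1 hq).2)
  have hN : (0 : ℝ) ≤ Fintype.card (Fin s → RowHashing b d) := Nat.cast_nonneg _
  generalize (Fintype.card (Fin s → RowHashing b d) : ℝ) = N at h hN ⊢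
  refine h.trans ((mul_le_mul_of_nonneg_right hI ?_).trans_eq ?_)
  · positivity
  · ring

theorem card_filter_error_le {w : Fin d → ℝ} {τ : ℝ}
    (h : ∀ i, 30 * ((Finset.univ.filter fun ω : RowHashing b d =>
      τ < |ω.error w i|).card : ℝ) ≤ Fintype.card (RowHashing b d)) :
    ((Finset.univ.filter fun H : Hashing s b d =>
      ∃ i, s < 4 * (Finset.univ.filter fun j => τ < |(H.row j).error w i|).card).card : ℝ) ≤
      Fintype.card (Hashing s b d) * (d * (3 / 4) ^ s) := by
  rw [card_filter_eq_card_filter_rows (p := fun r : Fin s → RowHashing b d =>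
    ∃ i, s < 4 * (Finset.univ.filter fun j => τ < |(r j).error w i|).card) fun _ => Iff.rfl,
    ← card_rows]
  have h1 := card_filter_le_card_mul (I := (Finset.univ : Finset (Fin d)))
    (q := fun r : Fin s → RowHashing b d =>
      ∃ i, s < 4 * (Finset.univ.filter fun j => τ < |(r j).error w i|).card)
    (p := fun i r => s < 4 * (Finset.univ.filter fun j => τ < |(r j).error w i|).card)
    (fun r ⟨i, hi⟩ => ⟨i, Finset.mem_univ i, hi⟩)
    (c := Fintype.card (Fin s → RowHashing b d) * (3 / 4) ^ s)
    fun i _ => by convert card_filter_lt_four_mul_card_le (h i)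
  rw [Finset.card_univ, Fintype.card_fin] at h1
  generalize (Fintype.card (Fin s → RowHashing b d) : ℝ) = N at h1 ⊢
  refine h1.trans_eq ?_
  ring

end Hashing

/-! ### Arithmetic of the sketch parameters -/

/-- A lower bound on the logarithm lets its higher powers dominate its first power; it would fail
for `d = 1` with `δ` near `1`. -/
theorem half_le_log_div {d : ℕ} {δ : ℝ} (hd : 2 ≤ d) (hδ : 0 < δ) (hδ1 : δ < 1) :
    1 / 2 ≤ Real.log (d / δ) := by
  have h2 : (2 : ℝ) ≤ d := by exact_mod_cast hd
  have h1 : (2 : ℝ) ≤ d / δ := by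
    rw [le_div_iff₀ hδ]
    linarith
  have := Real.log_le_log (by norm_num) h1
  have := Real.log_two_gt_d9
  linarith

theorem exp_neg_mul_log_div {d : ℕ} {δ : ℝ} (hd : 0 < d) (hδ : 0 < δ) (n : ℕ) :
    Real.exp (-(n * Real.log (d / δ))) = (δ / d) ^ n := by
  have hd' : (0 : ℝ) < d := by exact_mod_cast hd
  rw [← mul_neg, ← Real.log_inv, inv_div, Real.exp_nat_mul, Real.exp_log (by positivity)]

theorem two_mul_sq_mul_exp_le {d : ℕ} {δ x : ℝ} (hd : 2 ≤ d) (hδ : 0 < δ) (hδ1 : δ < 1)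
    (hx : 4 * Real.log (d / δ) ≤ x) : 2 * d ^ 2 * Real.exp (-x) ≤ δ / 2 := by
  have h2 : (2 : ℝ) ≤ d := by exact_mod_cast hd
  have h1 : Real.exp (-x) ≤ (δ / d) ^ 4 := by
    rw [← exp_neg_mul_log_div (by omega) hδ]
    exact Real.exp_le_exp.2 (by push_cast; linarith)
  calc _ ≤ 2 * (d : ℝ) ^ 2 * (δ / d) ^ 4 := by gcongr
    _ = δ * (δ ^ 3 * (2 / d ^ 2)) := by field_simp
    _ ≤ δ * (1 * (1 / 2)) := by
        have h3 : 2 / (d : ℝ) ^ 2 ≤ 1 / 2 := by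
          rw [div_le_div_iff₀ (by positivity) (by norm_num)]
          nlinarith
        have h4 : δ ^ 3 ≤ 1 := pow_le_one₀ hδ.le hδ1.le
        gcongr
    _ = _ := by ring

theorem mul_three_quarters_pow_le {d s : ℕ} {δ : ℝ} (hd : 2 ≤ d) (hδ : 0 < δ) (hδ1 : δ < 1)
    (hs : 2 * Real.log (d / δ) ≤ s / 4) : d * (3 / 4 : ℝ) ^ s ≤ δ / 2 := by
  have h2 : (2 : ℝ) ≤ d := by exact_mod_cast hd
  have h1 : (3 / 4 : ℝ) ^ s ≤ (δ / d) ^ 2 := by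
    calc (3 / 4 : ℝ) ^ s ≤ Real.exp (-(1 / 4)) ^ s := by
          refine pow_le_pow_left₀ (by norm_num) ?_ s
          have := Real.add_one_le_exp (-(1 / 4 : ℝ))
          linarith
      _ = Real.exp (-(s / 4)) := by
          rw [← Real.exp_nat_mul]
          congr 1
          ring
      _ ≤ Real.exp (-((2 : ℕ) * Real.log (d / δ))) :=
          Real.exp_le_exp.2 (by push_cast; linarith)
      _ = _ := exp_neg_mul_log_div (by omega) hδ 2
  calc _ ≤ (d : ℝ) * (δ / d) ^ 2 := by gcongr
    _ = δ * (δ * (1 / d)) := by field_simp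
    _ ≤ δ * (1 * (1 / 2)) := by gcongr
    _ = _ := by ring

theorem max_one_sq_eq {u : ℝ} (hu : 0 ≤ u) : max 1 (u ^ 2) = max 1 u ^ 2 := by
  rcases le_total 1 u with h | h
  · rw [max_eq_right h, max_eq_right (by nlinarith)]
  · rw [max_eq_left h, max_eq_left (by nlinarith), one_pow]

/-- For `ε < 2` and `d ≥ 2` the width is of order at least `ε⁻²`. -/
theorem le_sketchWidth_mul_sq {d : ℕ} {ε δ lam β γ : ℝ} (hd : 2 ≤ d) (hε : 0 < ε) (hε2 : ε < 2)
    (hδ : 0 < δ) (hδ1 : δ < 1) (hlam : 0 < lam) (hβ : 0 ≤ β) :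
    120 ≤ (sketchWidth (2 ^ 15) 64 ε δ d β γ lam : ℝ) * ε ^ 2 := by
  have hL := half_le_log_div hd hδ hδ1
  set L := Real.log (d / δ) with hLdef
  set M := max 1 (β * γ ^ 2 / lam) with hM
  have hM1 : 1 ≤ M := le_max_left _ _
  have hsize : nominalSize (2 ^ 15) ε δ d β γ lam = 2 ^ 15 / ε ^ 4 * L ^ 3 * M ^ 2 := by
    rw [nominalSize, hM, ← max_one_sq_eq (by positivity)]
    congr 2
    ring
  have hdepth : nominalDepth 64 ε δ d β γ lam = 64 / ε ^ 2 * L ^ 2 * M := rfl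
  set D := nominalDepth 64 ε δ d β γ lam
  -- A nominal depth of at least `1` is at most doubled by rounding up.
  have hD1 : 1 ≤ D := by
    rw [hdepth]
    have h1 : 16 ≤ 64 / ε ^ 2 := by
      rw [le_div_iff₀ (by positivity)]
      nlinarith
    have h2 : 1 / 4 ≤ L ^ 2 := by nlinarith
    calc (1 : ℝ) ≤ 16 * (1 / 4) * 1 := by norm_num
      _ ≤ _ := by gcongr
  have hs : (sketchDepth 64 ε δ d β γ lam : ℝ) ≤ 2 * D := by
    have := Nat.ceil_lt_add_one (R := ℝ) (a := D) (by linarith)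
    rw [sketchDepth]
    linarith
  have hs0 : (0 : ℝ) < sketchDepth 64 ε δ d β γ lam := by
    rw [sketchDepth]
    exact_mod_cast Nat.ceil_pos.2 (by linarith : 0 < D)
  have hb : nominalSize (2 ^ 15) ε δ d β γ lam / (2 * D) ≤
      sketchWidth (2 ^ 15) 64 ε δ d β γ lam := by
    refine le_trans ?_ (Nat.le_ceil _)
    have : 0 ≤ nominalSize (2 ^ 15) ε δ d β γ lam := by
      rw [hsize]
      positivity
    gcongr
  calc (120 : ℝ) ≤ 256 * (1 / 2) * 1 := by norm_num
    _ ≤ 256 * L * M := by gcongr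
    _ = nominalSize (2 ^ 15) ε δ d β γ lam / (2 * D) * ε ^ 2 := by
        rw [hsize, hdepth]
        field_simp
        norm_num
    _ ≤ _ := by gcongr

theorem log_div_pos {d : ℕ} {δ : ℝ} (hd : 0 < d) (hδ : 0 < δ) (hδ1 : δ < 1) :
    0 < Real.log (d / δ) := by
  have h1 : (1 : ℝ) ≤ d := by exact_mod_cast hd
  refine Real.log_pos ?_
  rw [lt_div_iff₀ hδ]
  linarith

/-! ### Assembly -/

theorem theorem1 :
    ∃ C₁ C₂ : ℝ, 0 < C₁ ∧ 0 < C₂ ∧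
      ∀ (d T : ℕ) (ε δ lam β γ : ℝ) (ℓ : ℝ → ℝ) (x : Fin T → Fin d → ℝ) (y : Fin T → ℝ),
        0 < d → 0 < ε → 0 < δ → δ < 1 → 0 < lam →
        ConvexOn ℝ Set.univ ℓ → StronglySmooth β ℓ →
        (∀ t, y t = 1 ∨ y t = -1) →
        IsGreatest (Set.range fun t => l1Norm (x t)) γ →
        ∀ wstar : Fin d → ℝ, IsMinimizer (objective ℓ lam x y) wstar →
          1 - δ ≤
            (ProbabilityTheory.uniformOn
              (Set.univ : Set (Hashing (sketchDepth C₂ ε δ d β γ lam)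
                (sketchWidth C₁ C₂ ε δ d β γ lam) d))).real
              {H | ∀ zstar,
                IsMinimizer
                  (objective ℓ lam (fun t => scaledCountSketchMatrix H *ᵥ x t) y) zstar →
                ∀ west : Fin d → ℝ, IsCountSketchRecovery H zstar west →
                  ‖wstar - west‖ ≤ ε * l1Norm wstar} := by
  -- With `64`, the Chernoff exponent `s a²/2` is at least `8 log² ≥ 4 log` for `d ≥ 2`. With `2 ^
  -- 15`, the width satisfies `b ε² ≥ (2 ^ 15 / 128) · log ≥ 128` for `d ≥ 2` and `ε < 2`, enough
  -- for the required `120`.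
  refine ⟨2 ^ 15, 64, by norm_num, by norm_num, ?_⟩
  intro d T ε δ lam β γ ℓ x y hd hε hδ hδ1 hlam hc hsm hy hγ w hw
  have hβ := hsm.nonneg_of_convexOn hc
  have hT : 0 < T := by
    obtain ⟨⟨t, _⟩, _⟩ := hγ
    exact t.pos
  have hL := log_div_pos hd hδ hδ1
  have hsnom : 64 / ε ^ 2 * Real.log (d / δ) ^ 2 * max 1 (β * γ ^ 2 / lam) ≤
      (sketchDepth 64 ε δ d β γ lam : ℝ) := Nat.le_ceil _
  set M := max 1 (β * γ ^ 2 / lam) with hM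
  have hM1 : 1 ≤ M := le_max_left _ _
  have hspos : 0 < sketchDepth 64 ε δ d β γ lam := by
    refine Nat.ceil_pos.2 ?_
    unfold nominalDepth
    positivity
  have hbpos : 0 < sketchWidth (2 ^ 15) 64 ε δ d β γ lam := by
    refine Nat.ceil_pos.2 (div_pos ?_ (by exact_mod_cast hspos))
    unfold nominalSize
    positivity
  have hbsq : 2 ≤ d → ε < 2 → 120 ≤ (sketchWidth (2 ^ 15) 64 ε δ d β γ lam : ℝ) * ε ^ 2 :=
    fun hd2 hε2 => le_sketchWidth_mul_sq hd2 hε hε2 hδ hδ1 hlam hβ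
  generalize sketchWidth (2 ^ 15) 64 ε δ d β γ lam = b at hbpos hbsq ⊢
  generalize sketchDepth 64 ε δ d β γ lam = s at hspos hsnom ⊢
  have : NeZero b := ⟨hbpos.ne'⟩
  have hN : (0 : ℝ) < Fintype.card (Hashing s b d) := by exact_mod_cast Fintype.card_pos
  have hw0 : 0 ≤ l1Norm w := Finset.sum_nonneg fun _ _ => abs_nonneg _
  -- Chosen so that `M a² = (ε/2)²`: the perturbation bound then becomes exactly `τ²/4`.
  set a := ε / (2 * √M) with ha
  have ha0 : 0 ≤ a := by positivity
  have hasq : a ^ 2 = ε ^ 2 / (4 * M) := by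
    rw [ha, div_pow, mul_pow, Real.sq_sqrt (by linarith)]
    norm_num
  set τ := ε / 2 * l1Norm w with hτ
  have hτ0 : 0 ≤ τ := by positivity
  have hd1 : d = 1 ∨ 2 ≤ d := by omega
  set B₁ := Finset.univ.filter fun H : Hashing s b d =>
    ∃ i i', i ≠ i' ∧ s * a < |∑ j, (H.row j).overlap i i'| with hB₁
  set B₂ := Finset.univ.filter fun H : Hashing s b d =>
    ∃ i, s < 4 * (Finset.univ.filter fun j => τ < |(H.row j).error w i|).card with hB₂
  have hcard₁ : (B₁.card : ℝ) ≤ δ / 2 * Fintype.card (Hashing s b d) := by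
    rcases hd1 with rfl | hd2
    · have : B₁ = ∅ := by
        rw [hB₁, Finset.filter_eq_empty_iff]
        rintro H _ ⟨i, i', hne, _⟩
        exact hne (Subsingleton.elim _ _)
      rw [this, Finset.card_empty, Nat.cast_zero]
      positivity
    · refine (Hashing.card_filter_overlap_le ha0).trans ?_
      rw [mul_comm]
      refine mul_le_mul_of_nonneg_right (two_mul_sq_mul_exp_le hd2 hδ hδ1 ?_) hN.le
      have hL2 := half_le_log_div hd2 hδ hδ1
      calc 4 * Real.log (d / δ) ≤ 8 * Real.log (d / δ) ^ 2 := by nlinarith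
        _ = 64 / ε ^ 2 * Real.log (d / δ) ^ 2 * M * a ^ 2 / 2 := by
            rw [hasq]
            field_simp
            norm_num
        _ ≤ _ := by gcongr
  have hcard₂ : (B₂.card : ℝ) ≤ δ / 2 * Fintype.card (Hashing s b d) := by
    -- The trivial case absorbs `d = 1` (no collisions) and `ε ≥ 2` (the error never exceeds
    -- `‖w‖₁`), where the logarithm and width bounds are unavailable.
    by_cases htriv : ∀ (ω : RowHashing b d) i, |ω.error w i| ≤ τ
    · have : B₂ = ∅ := by
        rw [hB₂, Finset.filter_eq_empty_iff]
        rintro H _ ⟨i, hi⟩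
        rw [Finset.filter_eq_empty_iff.2 fun j _ => not_lt.2 (htriv (H.row j) i)] at hi
        simp at hi
      rw [this, Finset.card_empty, Nat.cast_zero]
      positivity
    · have hd2 : 2 ≤ d := by
        refine hd1.resolve_left ?_
        rintro rfl
        refine htriv fun ω i => ?_
        have : (Finset.univ.erase i : Finset (Fin 1)) = ∅ := by
          rw [Subsingleton.elim i 0]
          rfl
        rw [RowHashing.error, this]
        simpa using hτ0
      have hε2 : ε < 2 := by
        by_contra! hcon
        refine htriv fun ω i => (ω.abs_error_le w i).trans ?_
        rw [hτ]
        nlinarith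
      refine (Hashing.card_filter_error_le fun i =>
        RowHashing.thirty_mul_card_filter_error_le w i hε (hbsq hd2 hε2)).trans ?_
      rw [mul_comm]
      refine mul_le_mul_of_nonneg_right (mul_three_quarters_pow_le hd2 hδ hδ1 ?_) hN.le
      have hL2 := half_le_log_div hd2 hδ hδ1
      have h1 : 16 ≤ 64 / ε ^ 2 := by
        rw [le_div_iff₀ (by positivity)]
        nlinarith
      have h2 : 16 * Real.log (d / δ) ^ 2 * 1 ≤ s :=
        le_trans (by gcongr) hsnom
      nlinarith
  refine one_sub_le_uniformOn_univ_real (B := B₁ ∪ B₂) ?_ ?_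
  · have h1 : ((B₁ ∪ B₂).card : ℝ) ≤ B₁.card + B₂.card := by
      exact_mod_cast Finset.card_union_le _ _
    linarith
  · intro H hH z hz west hwest
    rw [Finset.mem_union, not_or] at hH
    simp only [hB₁, hB₂, Finset.mem_filter, Finset.mem_univ, true_and, not_exists, not_and,
      not_lt] at hH
    have hclose := sum_sq_sub_mulVec_minimizer_le hT hlam hc hsm hy
      (fun t => hγ.2 (Set.mem_range_self t)) (mul_nonneg ha0 hw0) hw hz
      (H.abs_transpose_mulVec_mulVec_sub_le hspos w ha0 hH.1)
    have hclose' : β * γ ^ 2 / lam * ((a * l1Norm w) ^ 2 / 4) ≤ τ ^ 2 / 4 := by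
      calc _ ≤ M * ((a * l1Norm w) ^ 2 / 4) :=
            mul_le_mul_of_nonneg_right (le_max_right _ _) (by positivity)
        _ = τ ^ 2 / 4 := by
            rw [mul_pow, hasq, hτ]
            field_simp
            ring
    refine (pi_norm_le_iff_of_nonneg (by positivity)).2 fun i => ?_
    have h := H.recovery_error_le hspos hτ0 (hclose.trans hclose') hH.2 hwest i
    rw [Pi.sub_apply, Real.norm_eq_abs]
    refine h.trans_eq ?_
    rw [hτ]
    ring
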